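/- Let $t = t_0t_1t_2\cdots = 0110100110010110\cdots$ be the Thue--Morse word, i.e. the infinite word that begins with $0$ and is fixed by the morphism $0 \mapsto 01$, $1 \mapsto 10$. An occurrence of a word $v$ in a word $u$ is a position $|z|$ given by a factorization $u = zvs$; a word $u$ is a complete first return to a word $v$ if $u$ has $v$ as a prefix and as a suffix and contains exactly two occurrences of $v$. Privileged words are defined recursively: the empty word and the letters are privileged, and a word is privileged if it is a complete first return to a shorter privileged word. A palindrome is a word that equals its reversal (the empty word included). For $n \ge 0$ let $B(n)$ be the number of distinct factors of $t$ of length $n$ that are both privileged and palindromes. Then $B(n) \in \{0,1,2,4\}$ for every $n \ge 0$, and for each of the values $0$, $2$ and $4$ there are infinitely many $n$ at which $B(n)$ equals that value. Moreover, if $b_1 = 6$ and $b_n = 4b_{n-1} - 2$ for $n > 1$, then $B(b_n) = 4$ for all $n \ge 1$. -/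

import Mathlib

/-- An occurrence of `v` in `u` is a position at which `v` starts: the length of `z` in a
factorization `u = z v s`. -/
def wordOccurrences {α : Type*} (v u : List α) : Set ℕ :=
  {i | ∃ z s : List α, z.length = i ∧ z ++ v ++ s = u}

/-- `u` starts and ends with `v` and contains exactly two occurrences of `v`. -/
def IsCompleteFirstReturn {α : Type*} (u v : List α) : Prop :=
  v <+: u ∧ v <:+ u ∧ (wordOccurrences v u).ncard = 2

/-- Privileged words: the empty word, the letters, and every complete first return to a shorter
privileged word. -/
inductive IsPrivileged {α : Type*} : List α → Prop
  | nil : IsPrivileged []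
  | letter (a : α) : IsPrivileged [a]
  | completeReturn (u v : List α) (hv : IsPrivileged v) (hlen : v.length < u.length)
      (hret : IsCompleteFirstReturn u v) : IsPrivileged u

/-- `u` is a (finite) factor of the infinite word `w`: it is read off from `w` at some position. -/
def IsFactorOf {α : Type*} (w : ℕ → α) (u : List α) : Prop :=
  ∃ i : ℕ, u = List.ofFn (fun j : Fin u.length => w (i + j))

/-- The number of factors of length `n` of the infinite word `w` that are both privileged words
and palindromes. -/
noncomputable def privilegedPalindromeComplexity {α : Type*} (w : ℕ → α) (n : ℕ) : ℕ :=
  {u : List α | u.length = n ∧ IsFactorOf w u ∧ IsPrivileged u ∧ u.Palindrome}.ncard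

/-- The Thue-Morse morphism `0 ↦ 01`, `1 ↦ 10`. -/
def thueMorseMorphism (u : List (Fin 2)) : List (Fin 2) :=
  u.flatMap (fun a => if a = 0 then [0, 1] else [1, 0])

theorem thueMorseMorphism_length (u : List (Fin 2)) :
    (thueMorseMorphism u).length = 2 * u.length := by
  induction u with
  | nil => rfl
  | cons a u ih =>
    simp only [thueMorseMorphism, List.flatMap_cons, List.length_append, List.length_cons] at ih ⊢
    split <;> simp [ih] <;> omega

theorem thueMorseMorphism_iterate_length (n : ℕ) :
    (thueMorseMorphism^[n] [0]).length = 2 ^ n := by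
  induction n with
  | zero => rfl
  | succ n ih => rw [Function.iterate_succ_apply', thueMorseMorphism_length, ih, pow_succ']

/-- The Thue-Morse word, the limit of the iterates of the Thue-Morse morphism on the letter `0`:
its letter at position `n` (counted from `0`) is that of the `n`-th iterate, which has length
`2 ^ n > n`. -/
def thueMorse (n : ℕ) : Fin 2 :=
  (thueMorseMorphism^[n] [0])[n]'(by
    rw [thueMorseMorphism_iterate_length]; exact Nat.lt_two_pow_self)

/-!
A palindromic factor of odd length at least `5` would have a palindrome of length `5` in its middle,
and the Thue–Morse word has none; so the value `0` occurs at all odd lengths from `5` on. A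
palindrome of even length is determined by its right half. Desubstitution by the square of the
morphism shows that, up to exchanging the letters, only two right halves of each length occur
(`exists_half_of_palindrome`), so there are at most four palindromes of each length. Exchanging the
letters is an involution without fixed points on the privileged palindromes of positive length, so
their number is even (`even_ncard_privilegedPalindromes`); this leaves `0`, `2` and `4`.

For the values `2` and `4`, consider the map that applies the square of the morphism to a factor and
removes the first and the last letter of the image; it takes length `n` to length `4 * n - 2`. It is
injective and preserves palindromes. An image of length at least `6` occurs only at positions that
are `1` modulo `4` (`SameFactor.mod_four`), so the map also preserves complete first returns to
words of length at least `2`; hence it preserves the words obtained by iterated complete first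
returns from `00`, `11`, `010` or `101` (`HasReturnChain.trimmed_square`), all of which are
privileged. The four palindromes of length `6` are such words, which yields the value `4` along the
sequence `6, 22, 86, …`.

A privileged prefix of a privileged word is also a suffix (`IsPrivileged.suffix_of_prefix`), so a
word with a privileged prefix that is not a suffix is not privileged; the map preserves this
obstruction as well, provided the prefix is one of the words above. Of the four palindromes of
length `18`, two are obtained by iterated complete first returns and two are obstructed in this way,
which yields the value `2` along the sequence `18, 70, 278, …`.

Factors are handled as pairs of a position and a length. The map above sends the factor of length
`n` at `i` to the factor of length `4 * n - 2` at `4 * i + 1`.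
-/

/-! ### The Thue–Morse recursion -/

theorem thueMorseMorphism_cons (a : Fin 2) (u : List (Fin 2)) :
    thueMorseMorphism (a :: u) = a :: (a + 1) :: thueMorseMorphism u := by
  have h : (if a = 0 then [0, 1] else [1, 0] : List (Fin 2)) = [a, a + 1] := by
    revert a; decide
  simp [thueMorseMorphism, List.flatMap_cons, h]

theorem getElem?_thueMorseMorphism_two_mul (u : List (Fin 2)) (i : ℕ) :
    (thueMorseMorphism u)[2 * i]? = u[i]? := by
  induction u generalizing i with
  | nil => simp [thueMorseMorphism]
  | cons a u ih =>
    rw [thueMorseMorphism_cons]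
    cases i with
    | zero => simp
    | succ i => simpa [Nat.mul_succ] using ih i

theorem getElem?_thueMorseMorphism_two_mul_add_one (u : List (Fin 2)) (i : ℕ) :
    (thueMorseMorphism u)[2 * i + 1]? = u[i]?.map (· + 1) := by
  induction u generalizing i with
  | nil => simp [thueMorseMorphism]
  | cons a u ih =>
    rw [thueMorseMorphism_cons]
    cases i with
    | zero => simp
    | succ i => simpa [Nat.mul_succ] using ih i

theorem getElem?_thueMorseMorphism_iterate_succ (k n : ℕ) (hn : n < 2 ^ k) :
    (thueMorseMorphism^[k + 1] [0])[n]? = (thueMorseMorphism^[k] [0])[n]? := by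
  induction k generalizing n with
  | zero =>
    obtain rfl : n = 0 := by simpa using hn
    rfl
  | succ k ih =>
    rw [pow_succ] at hn
    rw [show thueMorseMorphism^[k + 1 + 1] [0] = thueMorseMorphism (thueMorseMorphism^[k + 1] [0])
        from Function.iterate_succ_apply' _ _ _,
      show thueMorseMorphism^[k + 1] [0] = thueMorseMorphism (thueMorseMorphism^[k] [0])
        from Function.iterate_succ_apply' _ _ _]
    simp only [Function.iterate_succ_apply' thueMorseMorphism k] at ih
    obtain ⟨i, rfl | rfl⟩ := n.even_or_odd'
    · rw [getElem?_thueMorseMorphism_two_mul, getElem?_thueMorseMorphism_two_mul,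
        ih i (by omega)]
    · rw [getElem?_thueMorseMorphism_two_mul_add_one,
        getElem?_thueMorseMorphism_two_mul_add_one, ih i (by omega)]

theorem getElem?_thueMorseMorphism_iterate_of_le {k l : ℕ} (hkl : k ≤ l) (n : ℕ)
    (hn : n < 2 ^ k) :
    (thueMorseMorphism^[l] [0])[n]? = (thueMorseMorphism^[k] [0])[n]? := by
  induction l, hkl using Nat.le_induction with
  | base => rfl
  | succ l hl ih =>
    rw [getElem?_thueMorseMorphism_iterate_succ l n
      (hn.trans_le (Nat.pow_le_pow_right two_pos hl)), ih]

/-- Every iterate of the morphism that is long enough shows the letter of the Thue–Morse word at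
position `n`. -/
theorem getElem?_thueMorseMorphism_iterate (k n : ℕ) (hn : n < 2 ^ k) :
    (thueMorseMorphism^[k] [0])[n]? = some (thueMorse n) := by
  have h : (thueMorseMorphism^[n] [0])[n]? = some (thueMorse n) := by
    simp [thueMorse]
  rw [← h]
  rcases le_total k n with hk | hk
  · exact (getElem?_thueMorseMorphism_iterate_of_le hk n hn).symm
  · exact getElem?_thueMorseMorphism_iterate_of_le hk n Nat.lt_two_pow_self

theorem thueMorse_two_mul (n : ℕ) : thueMorse (2 * n) = thueMorse n := by
  have hn : n < 2 ^ n := Nat.lt_two_pow_self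
  have h := getElem?_thueMorseMorphism_iterate (n + 1) (2 * n) (by rw [pow_succ]; omega)
  rw [Function.iterate_succ_apply', getElem?_thueMorseMorphism_two_mul,
    getElem?_thueMorseMorphism_iterate n n hn] at h
  exact (Option.some.inj h).symm

theorem thueMorse_two_mul_add_one (n : ℕ) : thueMorse (2 * n + 1) = thueMorse n + 1 := by
  have hn : n < 2 ^ n := Nat.lt_two_pow_self
  have h := getElem?_thueMorseMorphism_iterate (n + 1) (2 * n + 1) (by rw [pow_succ]; omega)
  rw [Function.iterate_succ_apply', getElem?_thueMorseMorphism_two_mul_add_one,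
    getElem?_thueMorseMorphism_iterate n n hn] at h
  exact (Option.some.inj h).symm

theorem thueMorse_four_mul (n : ℕ) : thueMorse (4 * n) = thueMorse n := by
  rw [show 4 * n = 2 * (2 * n) by ring, thueMorse_two_mul, thueMorse_two_mul]

theorem thueMorse_four_mul_add_one (n : ℕ) : thueMorse (4 * n + 1) = thueMorse n + 1 := by
  rw [show 4 * n + 1 = 2 * (2 * n) + 1 by ring, thueMorse_two_mul_add_one, thueMorse_two_mul]

theorem thueMorse_four_mul_add_two (n : ℕ) : thueMorse (4 * n + 2) = thueMorse n + 1 := by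
  rw [show 4 * n + 2 = 2 * (2 * n + 1) by ring, thueMorse_two_mul, thueMorse_two_mul_add_one]

theorem thueMorse_four_mul_add_three (n : ℕ) : thueMorse (4 * n + 3) = thueMorse n := by
  rw [show 4 * n + 3 = 2 * (2 * n + 1) + 1 by ring, thueMorse_two_mul_add_one,
    thueMorse_two_mul_add_one, add_assoc]
  simp

theorem thueMorse_zero : thueMorse 0 = 0 := rfl

theorem thueMorse_four_mul_add (n r : ℕ) (hr : r < 4) :
    thueMorse (4 * n + r) = thueMorse n + thueMorse r := by
  have h1 := thueMorse_four_mul_add_one 0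
  have h2 := thueMorse_four_mul_add_two 0
  have h3 := thueMorse_four_mul_add_three 0
  simp only [mul_zero, zero_add, thueMorse_zero] at h1 h2 h3
  interval_cases r
  · simp [thueMorse_four_mul, thueMorse_zero]
  · rw [thueMorse_four_mul_add_one, h1]
  · rw [thueMorse_four_mul_add_two, h2]
  · rw [thueMorse_four_mul_add_three, h3, add_zero]

/-- Adding `1` in `Fin 2` exchanges the two letters, so every prefix is followed somewhere by its
complement; hence the set of factors is closed under exchanging the letters. -/
theorem thueMorse_two_pow_add (k n : ℕ) (hn : n < 2 ^ k) :
    thueMorse (2 ^ k + n) = thueMorse n + 1 := by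
  induction k generalizing n with
  | zero =>
    obtain rfl : n = 0 := by simpa using hn
    exact thueMorse_two_mul_add_one 0
  | succ k ih =>
    rw [pow_succ] at hn
    obtain ⟨i, rfl | rfl⟩ := n.even_or_odd'
    · rw [show 2 ^ (k + 1) + 2 * i = 2 * (2 ^ k + i) by ring, thueMorse_two_mul,
        thueMorse_two_mul, ih i (by omega)]
    · rw [show 2 ^ (k + 1) + (2 * i + 1) = 2 * (2 ^ k + i) + 1 by ring,
        thueMorse_two_mul_add_one, thueMorse_two_mul_add_one, ih i (by omega)]

/-- The Thue–Morse word contains neither `000` nor `111`. -/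
theorem thueMorse_cube_free (e : ℕ) :
    ¬ (thueMorse e = thueMorse (e + 1) ∧ thueMorse (e + 1) = thueMorse (e + 2)) := by
  rintro ⟨h1, h2⟩
  have aux : ∀ a : Fin 2, a ≠ a + 1 := by decide
  obtain ⟨d, rfl | rfl⟩ := e.even_or_odd'
  · rw [thueMorse_two_mul, thueMorse_two_mul_add_one] at h1
    exact aux _ h1
  · rw [show 2 * d + 1 + 1 = 2 * (d + 1) by ring, thueMorse_two_mul,
      show 2 * d + 1 + 2 = 2 * (d + 1) + 1 by ring, thueMorse_two_mul_add_one] at h2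
    exact aux _ h2

/-! ### Factors given by a position and a length -/

/-- The factor of length `n` of the Thue–Morse word that starts at position `i`. -/
def factorAt (i n : ℕ) : List (Fin 2) :=
  (List.range n).map fun j => thueMorse (i + j)

/-- The factors of length `n` at the positions `i` and `j` are equal. -/
def SameFactor (i j n : ℕ) : Prop :=
  ∀ k < n, thueMorse (i + k) = thueMorse (j + k)

@[simp] theorem factorAt_length (i n : ℕ) : (factorAt i n).length = n := by
  simp [factorAt]

theorem factorAt_eq_iff {i j n : ℕ} : factorAt i n = factorAt j n ↔ SameFactor i j n := by
  simp [factorAt, SameFactor]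

theorem factorAt_add (i m n : ℕ) :
    factorAt i (m + n) = factorAt i m ++ factorAt (i + m) n := by
  simp [factorAt, List.range_add, Function.comp_def, add_assoc]

theorem isFactorOf_thueMorse_iff {u : List (Fin 2)} :
    IsFactorOf thueMorse u ↔ ∃ i, u = factorAt i u.length := by
  have h (i : ℕ) : List.ofFn (fun j : Fin u.length => thueMorse (i + j)) =
      factorAt i u.length :=
    List.ext_getElem (by simp) (by simp [factorAt])
  simp only [IsFactorOf, h]

theorem wordOccurrences_factorAt (i j m n : ℕ) :
    wordOccurrences (factorAt j m) (factorAt i n) =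
      {p | p + m ≤ n ∧ SameFactor j (i + p) m} := by
  ext p
  constructor
  · rintro ⟨z, s, hz, h⟩
    have hlen : p + m + s.length = n := by
      have := congrArg List.length h
      simp only [List.length_append, factorAt_length] at this
      omega
    subst hlen
    rw [factorAt_add, factorAt_add] at h
    obtain ⟨h, -⟩ := List.append_inj h (by simp [hz])
    obtain ⟨-, h⟩ := List.append_inj h (by simp [hz])
    exact ⟨by omega, factorAt_eq_iff.1 h⟩
  · rintro ⟨hp, h⟩
    obtain ⟨r, rfl⟩ := Nat.exists_eq_add_of_le hp
    refine ⟨factorAt i p, factorAt (i + (p + m)) r, by simp, ?_⟩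
    rw [factorAt_add, factorAt_add, factorAt_eq_iff.2 h]

theorem factorAt_prefix (i : ℕ) {m n : ℕ} (h : m ≤ n) : factorAt i m <+: factorAt i n := by
  obtain ⟨r, rfl⟩ := Nat.exists_eq_add_of_le h
  exact ⟨_, (factorAt_add i m r).symm⟩

theorem factorAt_suffix_iff {i j m n : ℕ} (h : m ≤ n) :
    factorAt j m <:+ factorAt i n ↔ SameFactor j (i + (n - m)) m := by
  obtain ⟨r, rfl⟩ := Nat.exists_eq_add_of_le' h
  rw [Nat.add_sub_cancel, factorAt_add, ← factorAt_eq_iff]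
  constructor
  · rintro ⟨z, hz⟩
    exact (List.append_inj' hz (by simp)).2
  · intro h
    exact ⟨factorAt i r, by rw [h]⟩

theorem isPrivileged_factorAt_of_return {i m n : ℕ} (hm : IsPrivileged (factorAt i m))
    (hmn : m < n) (hend : SameFactor i (i + (n - m)) m)
    (hno : ∀ p, 0 < p → p < n - m → ¬ SameFactor i (i + p) m) :
    IsPrivileged (factorAt i n) := by
  refine .completeReturn _ _ hm (by simpa) ⟨factorAt_prefix i hmn.le,
    (factorAt_suffix_iff hmn.le).2 hend, ?_⟩
  have h : wordOccurrences (factorAt i m) (factorAt i n) = {0, n - m} := by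
    rw [wordOccurrences_factorAt]
    ext p
    simp only [Set.mem_ofPred_eq, Set.mem_insert_iff, Set.mem_singleton_iff]
    constructor
    · rintro ⟨hp, h⟩
      by_contra! hne
      exact hno p (by omega) (by omega) h
    · rintro (rfl | rfl)
      · exact ⟨by omega, fun k _ => rfl⟩
      · exact ⟨by omega, hend⟩
  rw [h, Set.ncard_pair (by omega)]

/-! ### Chains of complete first returns -/

/-- The factor of length `n` at position `i` arises by successive complete first returns from one
of the words `00`, `11`, `010`, `101`. All of these are privileged, but a chain that starts at a
letter is admitted only if it passes through one of them: the word `0110`, a complete first return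
to a letter, would break `HasReturnChain.trimmed_square`. -/
inductive HasReturnChain (i : ℕ) : ℕ → Prop
  | square (h : thueMorse i = thueMorse (i + 1)) : HasReturnChain i 2
  | alternating (h : thueMorse (i + 1) = thueMorse i + 1)
      (h' : thueMorse (i + 2) = thueMorse i) : HasReturnChain i 3
  | firstReturn (m n : ℕ) (hm : HasReturnChain i m) (hmn : m < n)
      (hend : SameFactor i (i + (n - m)) m)
      (hno : ∀ p, 0 < p → p < n - m → ¬ SameFactor i (i + p) m) : HasReturnChain i n

theorem HasReturnChain.two_le {i n : ℕ} (h : HasReturnChain i n) : 2 ≤ n := by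
  induction h <;> omega

theorem HasReturnChain.isPrivileged {i n : ℕ} (h : HasReturnChain i n) :
    IsPrivileged (factorAt i n) := by
  have letter (i : ℕ) : IsPrivileged (factorAt i 1) := .letter (thueMorse i)
  have aux : ∀ a : Fin 2, a ≠ a + 1 := by decide
  induction h with
  | square h =>
    refine isPrivileged_factorAt_of_return (letter i) (by omega) (fun k hk => ?_)
      (fun p hp hp' => by omega)
    obtain rfl : k = 0 := by omega
    exact h
  | alternating h h' =>
    refine isPrivileged_factorAt_of_return (letter i) (by omega) (fun k hk => ?_)
      (fun p hp hp' hs => ?_)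
    · obtain rfl : k = 0 := by omega
      exact h'.symm
    · obtain rfl : p = 1 := by omega
      exact aux _ ((hs 0 one_pos).trans h)
  | firstReturn m n _ hmn hend hno ih => exact isPrivileged_factorAt_of_return ih hmn hend hno

/-! ### The square of the morphism, trimmed by one letter at each end -/

/-- The factor of length `n` at `i` has as its image under the square of the morphism the factor
of length `4 * n` at `4 * i`; without its first and last letter, this is the factor of length
`4 * n - 2` at `4 * i + 1`. -/
theorem SameFactor.trimmed_square {i j n : ℕ} (h : SameFactor i j n) :
    SameFactor (4 * i + 1) (4 * j + 1) (4 * n - 2) := by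
  intro k hk
  have hr : (k + 1) % 4 < 4 := Nat.mod_lt _ (by norm_num)
  rw [show 4 * i + 1 + k = 4 * (i + (k + 1) / 4) + (k + 1) % 4 by omega,
    show 4 * j + 1 + k = 4 * (j + (k + 1) / 4) + (k + 1) % 4 by omega,
    thueMorse_four_mul_add _ _ hr, thueMorse_four_mul_add _ _ hr, h _ (by omega)]

theorem SameFactor.of_trimmed_square {i j n : ℕ}
    (h : SameFactor (4 * i + 1) (4 * j + 1) (4 * n - 2)) : SameFactor i j n := by
  intro k hk
  have := h (4 * k) (by omega)
  rw [show 4 * i + 1 + 4 * k = 4 * (i + k) + 1 by ring,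
    show 4 * j + 1 + 4 * k = 4 * (j + k) + 1 by ring, thueMorse_four_mul_add_one,
    thueMorse_four_mul_add_one] at this
  exact add_right_cancel this

/-- Synchronization: a trimmed square of length at least `6` occurs only at positions that are
`1` modulo `4`. -/
theorem SameFactor.mod_four {i b : ℕ} (h : SameFactor (4 * i + 1) b 6) : b % 4 = 1 := by
  have h0 := h 0 (by norm_num)
  have h1 := h 1 (by norm_num)
  have h2 := h 2 (by norm_num)
  have h3 := h 3 (by norm_num)
  have h4 := h 4 (by norm_num)
  have h5 := h 5 (by norm_num)
  rw [show 4 * i + 1 + 0 = 4 * i + 1 by ring, thueMorse_four_mul_add_one] at h0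
  rw [show 4 * i + 1 + 1 = 4 * i + 2 by ring, thueMorse_four_mul_add_two] at h1
  rw [show 4 * i + 1 + 2 = 4 * i + 3 by ring, thueMorse_four_mul_add_three] at h2
  rw [show 4 * i + 1 + 3 = 4 * (i + 1) by ring, thueMorse_four_mul] at h3
  rw [show 4 * i + 1 + 4 = 4 * (i + 1) + 1 by ring, thueMorse_four_mul_add_one] at h4
  rw [show 4 * i + 1 + 5 = 4 * (i + 1) + 2 by ring, thueMorse_four_mul_add_two] at h5
  have hb : b % 4 < 4 := Nat.mod_lt _ (by norm_num)
  obtain ⟨e, he⟩ : ∃ e, b = 4 * e + b % 4 := ⟨b / 4, by omega⟩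
  generalize b % 4 = r at he hb ⊢
  subst he
  have a0 := thueMorse_four_mul e
  have a1 := thueMorse_four_mul_add_one e
  have a2 := thueMorse_four_mul_add_two e
  have a3 := thueMorse_four_mul_add_three e
  have a4 := thueMorse_four_mul (e + 1)
  have a5 := thueMorse_four_mul_add_one (e + 1)
  have a6 := thueMorse_four_mul_add_two (e + 1)
  have a7 := thueMorse_four_mul_add_three (e + 1)
  have a8 := thueMorse_four_mul (e + 2)
  simp only [mul_add, Nat.reduceMul, add_assoc, Nat.reduceAdd] at a4 a5 a6 a7 a8
  interval_cases r
  · simp only [add_zero, a0, a1] at h0 h1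
    rw [h0] at h1
    exact absurd h1 (by generalize thueMorse e = x; revert x; decide)
  · rfl
  · simp only [add_assoc, Nat.reduceAdd, add_zero, a2, a3] at h0 h1
    rw [h0] at h1
    exact absurd h1 (by generalize thueMorse e = x; revert x; decide)
  · simp only [add_assoc, Nat.reduceAdd, add_zero, a3, a4, a5, a6, a7, a8] at h0 h1 h2 h3 h4 h5
    refine absurd ?_ (thueMorse_cube_free e)
    rw [show e + 1 + 1 = e + 2 from rfl]
    generalize thueMorse e = x at *
    generalize thueMorse (e + 1) = y at *
    generalize thueMorse (e + 2) = z at *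
    generalize thueMorse i = v at *
    generalize thueMorse (i + 1) = w at *
    clear a0 a1 a2 a3 a4 a5 a6 a7 a8 h hb
    revert x y z v w
    decide

/-- The trimmed square preserves complete first returns, by synchronization; for the words of
length `2` and `3` at the bottom of a chain, the trimmed squares are complete first returns to
`00` or `11`. -/
theorem HasReturnChain.trimmed_square {i n : ℕ} (h : HasReturnChain i n) :
    HasReturnChain (4 * i + 1) (4 * n - 2) := by
  have base (i : ℕ) : HasReturnChain (4 * i + 1) 2 :=
    .square (by
      rw [thueMorse_four_mul_add_one, add_assoc, thueMorse_four_mul_add_two])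
  have a1 (i : ℕ) := thueMorse_four_mul_add_one i
  have a2 (i : ℕ) := thueMorse_four_mul_add_two i
  have a3 (i : ℕ) := thueMorse_four_mul_add_three i
  induction h with
  | square h =>
    have a4 := thueMorse_four_mul (i + 1)
    have a5 := thueMorse_four_mul_add_one (i + 1)
    have a6 := thueMorse_four_mul_add_two (i + 1)
    simp only [mul_add, Nat.reduceMul, add_assoc, Nat.reduceAdd] at a4 a5 a6
    refine .firstReturn _ _ (base i) (by norm_num) (fun k hk => ?_) (fun p hp hp' hs => ?_)
    · interval_cases k <;> simp [add_assoc, a1, a2, a5, a6, h]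
    · have h0 := hs 0 (by norm_num)
      have h1 := hs 1 (by norm_num)
      norm_num at hp'
      interval_cases p <;>
        simp only [add_assoc, Nat.reduceAdd, a1, a2, a3, a4, a5, ← h] at h0 h1 <;>
        revert h0 h1 <;> generalize thueMorse i = x <;> revert x <;> decide
  | alternating h h' =>
    have a4 := thueMorse_four_mul (i + 1)
    have a5 := thueMorse_four_mul_add_one (i + 1)
    have a6 := thueMorse_four_mul_add_two (i + 1)
    have a7 := thueMorse_four_mul_add_three (i + 1)
    have a8 := thueMorse_four_mul (i + 2)
    have a9 := thueMorse_four_mul_add_one (i + 2)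
    have a10 := thueMorse_four_mul_add_two (i + 2)
    simp only [mul_add, Nat.reduceMul, add_assoc, Nat.reduceAdd] at a4 a5 a6 a7 a8 a9 a10
    refine .firstReturn _ _ (base i) (by norm_num) (fun k hk => ?_) (fun p hp hp' hs => ?_)
    · interval_cases k <;> simp [add_assoc, a1, a2, a9, a10, h']
    · have h0 := hs 0 (by norm_num)
      have h1 := hs 1 (by norm_num)
      norm_num at hp'
      interval_cases p <;>
        simp only [add_assoc, Nat.reduceAdd, a1, a2, a3, a4, a5, a6, a7, a8, a9, h, h'] at h0 h1 <;>
        revert h0 h1 <;> generalize thueMorse i = x <;> revert x <;> decide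
  | firstReturn m n hm hmn hend hno ih =>
    have hm2 := hm.two_le
    refine .firstReturn _ _ ih (by omega) ?_ (fun p hp hp' hs => ?_)
    · rw [show 4 * i + 1 + (4 * n - 2 - (4 * m - 2)) = 4 * (i + (n - m)) + 1 by omega]
      exact hend.trimmed_square
    · have hmod : (4 * i + 1 + p) % 4 = 1 :=
        SameFactor.mod_four fun k hk => hs k (by omega)
      obtain ⟨q, rfl⟩ : ∃ q, p = 4 * q := ⟨p / 4, by omega⟩
      rw [show 4 * i + 1 + 4 * q = 4 * (i + q) + 1 by ring] at hs
      exact hno q (by omega) (by omega) hs.of_trimmed_square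

theorem palindrome_factorAt_iff {i n : ℕ} :
    (factorAt i n).Palindrome ↔ ∀ k < n, thueMorse (i + k) = thueMorse (i + (n - 1 - k)) := by
  rw [List.Palindrome.iff_reverse_eq, List.ext_getElem_iff]
  simp only [List.length_reverse, true_and, List.getElem_reverse, factorAt,
    List.getElem_map, List.getElem_range, List.length_map, List.length_range]
  exact ⟨fun h k hk => (h k hk hk).symm, fun h k hk _ => (h k hk).symm⟩

theorem palindrome_trimmed_square {i n : ℕ} (h : (factorAt i n).Palindrome) :
    (factorAt (4 * i + 1) (4 * n - 2)).Palindrome := by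
  rw [palindrome_factorAt_iff] at h ⊢
  intro k hk
  have hsymm : ∀ r < 4, thueMorse r = thueMorse (3 - r) := by
    intro r hr
    have h1 := thueMorse_four_mul_add_one 0
    have h2 := thueMorse_four_mul_add_two 0
    have h3 := thueMorse_four_mul_add_three 0
    simp only [mul_zero, zero_add] at h1 h2 h3
    interval_cases r <;> simp [h1, h2, h3]
  have hr : (k + 1) % 4 < 4 := Nat.mod_lt _ (by norm_num)
  rw [show 4 * i + 1 + k = 4 * (i + (k + 1) / 4) + (k + 1) % 4 by omega,
    show 4 * i + 1 + (4 * n - 2 - 1 - k) =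
      4 * (i + (n - 1 - (k + 1) / 4)) + (3 - (k + 1) % 4) by omega,
    thueMorse_four_mul_add _ _ hr, thueMorse_four_mul_add _ _ (by omega), h _ (by omega),
    hsymm _ hr]

/-! ### Borders of privileged words -/

/-- A privileged prefix of a privileged word is also a suffix of it. -/
theorem IsPrivileged.suffix_of_prefix {α : Type*} {u v : List α} (hu : IsPrivileged u)
    (hv : IsPrivileged v) (h : v <+: u) : v <:+ u := by
  induction hn : u.length using Nat.strong_induction_on generalizing u v with
  | _ n ih =>
    subst hn
    rcases h.length_le.eq_or_lt with hlen | hlen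
    · rw [h.eq_of_length hlen]
    cases hu with
    | nil => simp at hlen
    | letter a =>
      obtain rfl : v = [] := by simpa using hlen
      exact List.nil_suffix
    | completeReturn _ w hw hwu hret =>
      obtain ⟨hpre, hsuf, hcard⟩ := hret
      rcases le_or_gt v.length w.length with hvw | hwv
      · exact (ih _ hwu hw hv (List.prefix_of_prefix_length_le h hpre hvw) rfl).trans hsuf
      · -- Otherwise `w` has three occurrences: as a prefix of `u`, as a suffix of `v`, and as a
        -- suffix of `u`.
        have hwv' : w <:+ v :=
          ih _ hlen hv hw (List.prefix_of_prefix_length_le hpre h hwv.le) rfl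
        obtain ⟨x, y, -, hxy⟩ := Set.ncard_eq_two.1 hcard
        have h0 : 0 ∈ wordOccurrences w u := by
          obtain ⟨s, hs⟩ := hpre
          exact ⟨[], s, rfl, by simpa using hs⟩
        have h1 : v.length - w.length ∈ wordOccurrences w u := by
          obtain ⟨z, rfl⟩ := hwv'
          obtain ⟨s, hs⟩ := h
          exact ⟨z, s, by simp, hs⟩
        have h2 : u.length - w.length ∈ wordOccurrences w u := by
          obtain ⟨z, rfl⟩ := hsuf
          exact ⟨z, [], by simp, by simp⟩
        simp only [hxy, Set.mem_insert_iff, Set.mem_singleton_iff] at h0 h1 h2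
        omega

/-! ### Exchanging the letters -/

/-- The word obtained by exchanging the two letters. -/
def complementWord (u : List (Fin 2)) : List (Fin 2) :=
  u.map (· + 1)

@[simp] theorem complementWord_length (u : List (Fin 2)) :
    (complementWord u).length = u.length := by
  simp [complementWord]

theorem complementWord_complementWord (u : List (Fin 2)) :
    complementWord (complementWord u) = u := by
  have h : ∀ a : Fin 2, a + 1 + 1 = a := by decide
  simp [complementWord, Function.comp_def, h]

theorem complementWord_ne_self {u : List (Fin 2)} (hu : u ≠ []) : complementWord u ≠ u := by
  have h : ∀ a : Fin 2, a + 1 ≠ a := by decide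
  cases u with
  | nil => exact absurd rfl hu
  | cons a u => simp [complementWord, h a]

theorem wordOccurrences_complementWord (v u : List (Fin 2)) :
    wordOccurrences (complementWord v) (complementWord u) = wordOccurrences v u := by
  have h (v u : List (Fin 2)) :
      wordOccurrences v u ⊆ wordOccurrences (complementWord v) (complementWord u) := by
    rintro i ⟨z, s, hz, rfl⟩
    exact ⟨complementWord z, complementWord s, by simpa using hz, by simp [complementWord]⟩
  refine Set.Subset.antisymm ?_ (h v u)
  simpa only [complementWord_complementWord] using h (complementWord v) (complementWord u)

theorem IsPrivileged.complementWord {u : List (Fin 2)} (hu : IsPrivileged u) :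
    IsPrivileged (complementWord u) := by
  induction hu with
  | nil => exact .nil
  | letter a => exact .letter (a + 1)
  | completeReturn u v _ hlen hret ih =>
    refine .completeReturn _ _ ih (by simpa using hlen) ⟨hret.1.map _, hret.2.1.map _, ?_⟩
    rw [wordOccurrences_complementWord, hret.2.2]

theorem IsFactorOf.complementWord {u : List (Fin 2)} (hu : IsFactorOf thueMorse u) :
    IsFactorOf thueMorse (complementWord u) := by
  rw [isFactorOf_thueMorse_iff] at hu ⊢
  obtain ⟨i, hi⟩ := hu
  refine ⟨2 ^ (i + u.length) + i, ?_⟩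
  have hlt : i + u.length < 2 ^ (i + u.length) := Nat.lt_two_pow_self
  rw [complementWord_length]
  conv_lhs => rw [hi]
  simp only [_root_.complementWord, factorAt, List.map_map, List.map_inj_left, List.mem_range,
    Function.comp_apply]
  intro k hk
  rw [add_assoc, thueMorse_two_pow_add _ _ (by omega)]

theorem List.Palindrome.complementWord {u : List (Fin 2)} (hu : u.Palindrome) :
    (complementWord u).Palindrome := by
  rw [List.Palindrome.iff_reverse_eq] at hu ⊢
  rw [_root_.complementWord, ← List.map_reverse, hu]

/-! ### Palindromic factors -/

/-- The Thue–Morse word has no palindromic factor of length `5`. -/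
theorem thueMorse_no_palindrome_five (e : ℕ) :
    ¬ (thueMorse e = thueMorse (e + 4) ∧ thueMorse (e + 1) = thueMorse (e + 3)) := by
  rintro ⟨h1, h2⟩
  obtain ⟨d, rfl | rfl⟩ := e.even_or_odd'
  · have hc' := thueMorse_cube_free d
    have a0 := thueMorse_two_mul d
    have a1 := thueMorse_two_mul_add_one d
    have a2 := thueMorse_two_mul (d + 1)
    have a3 := thueMorse_two_mul_add_one (d + 1)
    have a4 := thueMorse_two_mul (d + 2)
    simp only [mul_add, Nat.reduceMul, add_assoc, Nat.reduceAdd] at a2 a3 a4 h1 h2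
    rw [a0, a4] at h1
    rw [a1, a3] at h2
    exact hc' ⟨add_right_cancel h2, by rw [← add_right_cancel h2, h1]⟩
  · have hc' := thueMorse_cube_free d
    have a1 := thueMorse_two_mul_add_one d
    have a2 := thueMorse_two_mul (d + 1)
    have a3 := thueMorse_two_mul_add_one (d + 1)
    have a4 := thueMorse_two_mul (d + 2)
    have a5 := thueMorse_two_mul_add_one (d + 2)
    simp only [mul_add, Nat.reduceMul, add_assoc, Nat.reduceAdd] at a2 a3 a4 a5 h1 h2
    rw [a1, a5] at h1
    rw [a2, a4] at h2
    exact hc' ⟨by rw [add_right_cancel h1, h2], h2⟩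

theorem even_of_thueMorse_eq_pred {c : ℕ} (hc : 1 ≤ c) (h : thueMorse c = thueMorse (c - 1)) :
    Even c := by
  have aux : ∀ a : Fin 2, a + 1 ≠ a := by decide
  obtain ⟨d, rfl | rfl⟩ := c.even_or_odd'
  · exact even_two_mul d
  · rw [Nat.add_sub_cancel, thueMorse_two_mul, thueMorse_two_mul_add_one] at h
    exact absurd h (aux _)

theorem thueMorse_add_of_palindrome_le_two {m c : ℕ} (hm : m ≤ 2) (hc : m ≤ c)
    (h : ∀ j < m, thueMorse (c + j) = thueMorse (c - 1 - j)) :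
    ∀ j < m, thueMorse (c + j) = thueMorse c + thueMorse j := by
  intro j hj
  obtain ⟨d, hd⟩ := (even_of_thueMorse_eq_pred (by omega) (h 0 (by omega))).exists_two_nsmul _
  rw [smul_eq_mul] at hd
  subst hd
  have h1 := thueMorse_two_mul_add_one 0
  simp only [mul_zero, zero_add, thueMorse_zero] at h1
  have hj2 : j < 2 := by omega
  interval_cases j
  · simp [thueMorse_zero]
  · rw [thueMorse_two_mul_add_one, thueMorse_two_mul, h1]

/-- The right halves of the palindromic factors of length `2 * m`, normalised to begin with `0`,
are at most two words, one of which is a prefix of the Thue–Morse word. If the centre is a multiple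
of `4`, the palindrome desubstitutes to one of about a quarter of the length; if not, it is centred
in the middle of the image of a letter under the square of the morphism, and short because the
palindromes of odd length are. -/
theorem exists_half_of_palindrome (m : ℕ) : ∃ s : ℕ → Fin 2, ∀ c, m ≤ c →
    (∀ j < m, thueMorse (c + j) = thueMorse (c - 1 - j)) →
    (∀ j < m, thueMorse (c + j) = thueMorse c + thueMorse j) ∨
      ∀ j < m, thueMorse (c + j) = thueMorse c + s j := by
  induction m using Nat.strong_induction_on with
  | _ m ih =>
    rcases le_or_gt m 2 with hm2 | hm2
    · exact ⟨thueMorse, fun c hc h => .inl (thueMorse_add_of_palindrome_le_two hm2 hc h)⟩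
    have hdesub (e : ℕ) (hc : m ≤ 4 * e)
        (h : ∀ j < m, thueMorse (4 * e + j) = thueMorse (4 * e - 1 - j)) :
        ∀ j < (m + 3) / 4, thueMorse (e + j) = thueMorse (e - 1 - j) := by
      intro j hj
      have := h (4 * j) (by omega)
      rwa [show 4 * e + 4 * j = 4 * (e + j) by ring,
        show 4 * e - 1 - 4 * j = 4 * (e - 1 - j) + 3 by omega, thueMorse_four_mul,
        thueMorse_four_mul_add_three] at this
    have hsub (e j : ℕ) : thueMorse (4 * e + j) = thueMorse (e + j / 4) + thueMorse (j % 4) := by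
      rw [← thueMorse_four_mul_add _ _ (Nat.mod_lt _ (by norm_num))]
      congr 1
      omega
    have hsub0 (j : ℕ) : thueMorse j = thueMorse (j / 4) + thueMorse (j % 4) := by
      simpa using hsub 0 j
    have hcase (c : ℕ) (hc : m ≤ c)
        (h : ∀ j < m, thueMorse (c + j) = thueMorse (c - 1 - j)) :
        (∃ e, c = 4 * e) ∨ ∃ e, c = 4 * (e + 1) + 2 ∧ thueMorse (e + 2) = thueMorse e := by
      obtain ⟨d, hd⟩ :=
        (even_of_thueMorse_eq_pred (by omega) (h 0 (by omega))).exists_two_nsmul _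
      rw [smul_eq_mul] at hd
      obtain hmod | hmod : c % 4 = 0 ∨ c % 4 = 2 := by omega
      · exact .inl ⟨c / 4, by omega⟩
      · obtain ⟨e, rfl⟩ : ∃ e, c = 4 * (e + 1) + 2 := by
          refine ⟨c / 4 - 1, ?_⟩
          have : c ≠ 2 := by omega
          omega
        refine .inr ⟨e, rfl, ?_⟩
        have := h 2 hm2
        rwa [show 4 * (e + 1) + 2 + 2 = 4 * (e + 2) by ring,
          show 4 * (e + 1) + 2 - 1 - 2 = 4 * e + 3 by omega, thueMorse_four_mul,
          thueMorse_four_mul_add_three] at this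
    rcases le_or_gt m 6 with hm6 | hm6
    · -- `010110` is the right half of `011010010110`, the image of `010` under the square of
      -- the morphism.
      refine ⟨fun j => [0, 1, 0, 1, 1, 0].getD j 0, fun c hc h => ?_⟩
      rcases hcase c hc h with ⟨e, rfl⟩ | ⟨e, rfl, he⟩
      · left
        have h4 := thueMorse_add_of_palindrome_le_two (by omega) (by omega) (hdesub e hc h)
        intro j hj
        rw [hsub, h4 _ (by omega), thueMorse_four_mul, hsub0 j, add_assoc]
      · right
        have hne : thueMorse (e + 1) = thueMorse e + 1 := by
          have := thueMorse_cube_free e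
          rw [he] at this
          revert this
          generalize thueMorse e = a
          generalize thueMorse (e + 1) = b
          revert a b
          decide
        intro j hj
        have a2 := thueMorse_four_mul_add_two (e + 1)
        have a3 := thueMorse_four_mul_add_three (e + 1)
        have a4 := thueMorse_four_mul (e + 2)
        have a5 := thueMorse_four_mul_add_one (e + 2)
        have a6 := thueMorse_four_mul_add_two (e + 2)
        have a7 := thueMorse_four_mul_add_three (e + 2)
        simp only [mul_add, Nat.reduceMul, add_assoc, Nat.reduceAdd] at a2 a3 a4 a5 a6 a7 ⊢
        have hj6 : j < 6 := by omega
        interval_cases j <;>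
          simp only [Nat.reduceAdd, add_zero, a2, a3, a4, a5, a6, a7, hne, he] <;>
          generalize thueMorse e = a <;> revert a <;> decide
    · obtain ⟨s, hs⟩ := ih ((m + 3) / 4) (by omega)
      refine ⟨fun j => s (j / 4) + thueMorse (j % 4), fun c hc h => ?_⟩
      rcases hcase c hc h with ⟨e, rfl⟩ | ⟨e, rfl, he⟩
      · refine (hs e (by omega) (hdesub e hc h)).imp (fun h' j hj => ?_) (fun h' j hj => ?_)
        · rw [hsub, h' _ (by omega), thueMorse_four_mul, hsub0 j, add_assoc]
        · rw [hsub, h' _ (by omega), thueMorse_four_mul, add_assoc]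
      · exfalso
        obtain ⟨e, rfl⟩ : ∃ e', e = e' + 1 := ⟨e - 1, by omega⟩
        have h6 := h 6 hm6
        rw [show 4 * (e + 1 + 1) + 2 + 6 = 4 * (e + 4) by ring,
          show 4 * (e + 1 + 1) + 2 - 1 - 6 = 4 * e + 3 by omega, thueMorse_four_mul,
          thueMorse_four_mul_add_three] at h6
        exact thueMorse_no_palindrome_five e ⟨h6.symm, he.symm⟩

/-- The palindromic factors of length `n` of the Thue–Morse word. -/
def palindromicFactors (n : ℕ) : Set (List (Fin 2)) :=
  {u | u.length = n ∧ IsFactorOf thueMorse u ∧ u.Palindrome}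

theorem mem_palindromicFactors_iff {n : ℕ} {u : List (Fin 2)} :
    u ∈ palindromicFactors n ↔ ∃ i, u = factorAt i n ∧ (factorAt i n).Palindrome := by
  rw [palindromicFactors, Set.mem_ofPred_eq, isFactorOf_thueMorse_iff]
  constructor
  · rintro ⟨rfl, ⟨i, hi⟩, h⟩
    exact ⟨i, hi, hi ▸ h⟩
  · rintro ⟨i, rfl, h⟩
    exact ⟨by simp, ⟨i, by simp⟩, h⟩

theorem palindromicFactors_eq_empty_of_odd {m : ℕ} (hm : 2 ≤ m) :
    palindromicFactors (2 * m + 1) = ∅ := by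
  rw [Set.eq_empty_iff_forall_notMem]
  intro u hu
  obtain ⟨i, -, h⟩ := mem_palindromicFactors_iff.1 hu
  rw [palindrome_factorAt_iff] at h
  obtain ⟨m, rfl⟩ : ∃ m', m = m' + 2 := ⟨m - 2, by omega⟩
  have h0 := h m (by omega)
  have h1 := h (m + 1) (by omega)
  rw [show i + (2 * (m + 2) + 1 - 1 - m) = i + m + 4 by omega] at h0
  rw [show i + (2 * (m + 2) + 1 - 1 - (m + 1)) = i + m + 3 by omega] at h1
  exact thueMorse_no_palindrome_five (i + m) ⟨h0, h1⟩

theorem exists_palindromicFactors_subset_range (n : ℕ) :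
    ∃ f : Fin 2 × Fin 2 → List (Fin 2), palindromicFactors n ⊆ Set.range f := by
  obtain ⟨m, rfl | rfl⟩ := n.even_or_odd'
  · obtain ⟨s, hs⟩ := exists_half_of_palindrome m
    let half (p : Fin 2 × Fin 2) : List (Fin 2) :=
      (List.range m).map fun j => p.2 + if p.1 = 0 then thueMorse j else s j
    refine ⟨fun p => (half p).reverse ++ half p, fun u hu => ?_⟩
    obtain ⟨i, rfl, h⟩ := mem_palindromicFactors_iff.1 hu
    have hright : factorAt i (2 * m) =
        (factorAt (i + m) m).reverse ++ factorAt (i + m) m := by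
      have h' := h.reverse_eq
      rw [two_mul, factorAt_add, List.reverse_append] at h'
      rw [two_mul, factorAt_add, (List.append_inj h' (by simp)).1]
    rw [palindrome_factorAt_iff] at h
    have hsymm : ∀ j < m, thueMorse (i + m + j) = thueMorse (i + m - 1 - j) := by
      intro j hj
      have := h (m + j) (by omega)
      rwa [← add_assoc, show i + (2 * m - 1 - (m + j)) = i + m - 1 - j by omega] at this
    rw [hright]
    rcases hs (i + m) (by omega) hsymm with h' | h'
    · have : factorAt (i + m) m = half (0, thueMorse (i + m)) := by
        simpa [half, factorAt] using h'
      exact ⟨(0, thueMorse (i + m)), by rw [this]⟩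
    · have : factorAt (i + m) m = half (1, thueMorse (i + m)) := by
        simpa [half, factorAt] using h'
      exact ⟨(1, thueMorse (i + m)), by rw [this]⟩
  · rcases le_or_gt 2 m with hm | hm
    · exact ⟨fun _ => [], by simp [palindromicFactors_eq_empty_of_odd hm]⟩
    · interval_cases m
      · refine ⟨fun p => [p.1], ?_⟩
        rintro u ⟨hu, -, -⟩
        obtain ⟨a, rfl⟩ := List.length_eq_one_iff.1 hu
        exact ⟨(a, 0), rfl⟩
      · refine ⟨fun p => [p.1, p.2, p.1], ?_⟩
        rintro u ⟨hu, -, h⟩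
        obtain ⟨a, b, c, rfl⟩ := List.length_eq_three.1 hu
        have := h.reverse_eq
        simp only [List.reverse_cons, List.reverse_nil, List.nil_append, List.cons_append,
          List.cons.injEq] at this
        exact ⟨(a, b), by rw [this.1]⟩

theorem palindromicFactors_finite (n : ℕ) : (palindromicFactors n).Finite := by
  obtain ⟨f, hf⟩ := exists_palindromicFactors_subset_range n
  exact (Set.finite_range f).subset hf

theorem ncard_palindromicFactors_le (n : ℕ) : (palindromicFactors n).ncard ≤ 4 := by
  obtain ⟨f, hf⟩ := exists_palindromicFactors_subset_range n
  refine (Set.ncard_le_ncard hf (Set.finite_range f)).trans ?_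
  rw [← Set.image_univ]
  refine (Set.ncard_image_le Set.finite_univ).trans ?_
  simp [Set.ncard_univ]

/-! ### Privileged palindromes -/

/-- The factors of length `n` of the Thue–Morse word that are privileged palindromes. -/
def privilegedPalindromes (n : ℕ) : Set (List (Fin 2)) :=
  {u | u.length = n ∧ IsFactorOf thueMorse u ∧ IsPrivileged u ∧ u.Palindrome}

theorem privilegedPalindromes_subset (n : ℕ) :
    privilegedPalindromes n ⊆ palindromicFactors n :=
  fun _ ⟨h1, h2, _, h3⟩ => ⟨h1, h2, h3⟩

theorem privilegedPalindromes_finite (n : ℕ) : (privilegedPalindromes n).Finite :=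
  (palindromicFactors_finite n).subset (privilegedPalindromes_subset n)

theorem ncard_privilegedPalindromes_le (n : ℕ) : (privilegedPalindromes n).ncard ≤ 4 :=
  (Set.ncard_le_ncard (privilegedPalindromes_subset n) (palindromicFactors_finite n)).trans
    (ncard_palindromicFactors_le n)

theorem HasReturnChain.mem_privilegedPalindromes {i n : ℕ} (h : HasReturnChain i n)
    (hp : (factorAt i n).Palindrome) : factorAt i n ∈ privilegedPalindromes n :=
  ⟨by simp, isFactorOf_thueMorse_iff.2 ⟨i, by simp⟩, h.isPrivileged, hp⟩

/-- Exchanging the letters is an involution of the privileged palindromes of length `n` without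
fixed points. -/
theorem even_ncard_privilegedPalindromes {n : ℕ} (hn : n ≠ 0) :
    Even (privilegedPalindromes n).ncard := by
  have hfin := privilegedPalindromes_finite n
  rw [Set.ncard_eq_toFinset_card _ hfin, ← ZMod.natCast_eq_zero_iff_even,
    Finset.cast_card]
  refine Finset.sum_involution (fun u _ => complementWord u) (fun _ _ => by decide)
    (fun u hu _ => complementWord_ne_self ?_) (fun u hu => ?_)
    (fun u _ => complementWord_complementWord u)
  · rintro rfl
    rw [Set.Finite.mem_toFinset] at hu
    exact hn hu.1.symm
  · rw [Set.Finite.mem_toFinset] at hu ⊢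
    exact ⟨by simpa using hu.1, hu.2.1.complementWord, hu.2.2.1.complementWord,
      hu.2.2.2.complementWord⟩

theorem ncard_privilegedPalindromes_mem (n : ℕ) :
    (privilegedPalindromes n).ncard ∈ ({0, 1, 2, 4} : Set ℕ) := by
  simp only [Set.mem_insert_iff, Set.mem_singleton_iff]
  rcases eq_or_ne n 0 with rfl | hn
  · have : privilegedPalindromes 0 ⊆ {[]} := fun u hu => List.length_eq_zero_iff.1 hu.1
    have := Set.ncard_le_ncard this
    rw [Set.ncard_singleton] at this
    omega
  · have h4 := ncard_privilegedPalindromes_le n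
    obtain ⟨k, hk⟩ := even_ncard_privilegedPalindromes hn
    omega

/-- There are four different palindromic factors of length `n` with a chain of complete first
returns. -/
def FourChainedPalindromes (n : ℕ) : Prop :=
  ∃ p : Fin 4 → ℕ, (∀ a, HasReturnChain (p a) n ∧ (factorAt (p a) n).Palindrome) ∧
    ∀ a b, a ≠ b → ¬ SameFactor (p a) (p b) n

/-- There are two palindromic factors of length `n` with a chain of complete first returns, and
two that are not privileged because one of their privileged prefixes is not a suffix. -/
def TwoChainedPalindromes (n : ℕ) : Prop :=
  ∃ p q : Fin 2 → ℕ, (∀ a, HasReturnChain (p a) n ∧ (factorAt (p a) n).Palindrome) ∧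
    (∀ a, (factorAt (q a) n).Palindrome ∧
      ∃ m < n, HasReturnChain (q a) m ∧ ¬ SameFactor (q a) (q a + (n - m)) m) ∧
    ¬ SameFactor (p 0) (p 1) n ∧ ¬ SameFactor (q 0) (q 1) n

theorem FourChainedPalindromes.trimmed_square {n : ℕ} (h : FourChainedPalindromes n) :
    FourChainedPalindromes (4 * n - 2) := by
  obtain ⟨p, hp, hne⟩ := h
  exact ⟨fun a => 4 * p a + 1,
    fun a => ⟨(hp a).1.trimmed_square, palindrome_trimmed_square (hp a).2⟩,
    fun a b hab hs => hne a b hab hs.of_trimmed_square⟩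

theorem TwoChainedPalindromes.trimmed_square {n : ℕ} (h : TwoChainedPalindromes n) :
    TwoChainedPalindromes (4 * n - 2) := by
  obtain ⟨p, q, hp, hq, hpne, hqne⟩ := h
  refine ⟨fun a => 4 * p a + 1, fun a => 4 * q a + 1,
    fun a => ⟨(hp a).1.trimmed_square, palindrome_trimmed_square (hp a).2⟩, fun a => ?_,
    fun hs => hpne hs.of_trimmed_square, fun hs => hqne hs.of_trimmed_square⟩
  obtain ⟨hpal, m, hmn, hm, hno⟩ := hq a
  have hm2 := hm.two_le
  refine ⟨palindrome_trimmed_square hpal, 4 * m - 2, by omega, hm.trimmed_square, fun hs => ?_⟩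
  rw [show 4 * q a + 1 + (4 * n - 2 - (4 * m - 2)) = 4 * (q a + (n - m)) + 1 by omega] at hs
  exact hno hs.of_trimmed_square

theorem FourChainedPalindromes.ncard_eq {n : ℕ} (h : FourChainedPalindromes n) :
    (privilegedPalindromes n).ncard = 4 := by
  obtain ⟨p, hp, hne⟩ := h
  refine le_antisymm (ncard_privilegedPalindromes_le n) ?_
  have hinj : Function.Injective fun a => factorAt (p a) n := by
    intro a b hab
    by_contra hne'
    exact hne a b hne' (factorAt_eq_iff.1 hab)
  have hsub : (fun a => factorAt (p a) n) '' Set.univ ⊆ privilegedPalindromes n := by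
    rintro _ ⟨a, -, rfl⟩
    exact (hp a).1.mem_privilegedPalindromes (hp a).2
  have := Set.ncard_le_ncard hsub (privilegedPalindromes_finite n)
  rw [Set.ncard_image_of_injective _ hinj] at this
  simpa [Set.ncard_univ] using this

theorem TwoChainedPalindromes.ncard_eq {n : ℕ} (h : TwoChainedPalindromes n) :
    (privilegedPalindromes n).ncard = 2 := by
  obtain ⟨p, q, hp, hq, hpne, hqne⟩ := h
  have hfin := palindromicFactors_finite n
  have hnot (a : Fin 2) : ¬ IsPrivileged (factorAt (q a) n) := by
    intro hpriv
    obtain ⟨-, m, hmn, hm, hno⟩ := hq a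
    exact hno ((factorAt_suffix_iff hmn.le).1
      (hpriv.suffix_of_prefix hm.isPrivileged (factorAt_prefix _ hmn.le)))
  refine le_antisymm ?_ ?_
  · have hpair : ({factorAt (q 0) n, factorAt (q 1) n} : Set (List (Fin 2))) ⊆
        palindromicFactors n := by
      rintro _ (rfl | rfl)
      · exact mem_palindromicFactors_iff.2 ⟨_, rfl, (hq 0).1⟩
      · exact mem_palindromicFactors_iff.2 ⟨_, rfl, (hq 1).1⟩
    have hsub : privilegedPalindromes n ⊆
        palindromicFactors n \ {factorAt (q 0) n, factorAt (q 1) n} := by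
      refine fun u hu => ⟨privilegedPalindromes_subset n hu, ?_⟩
      rintro (rfl | rfl)
      · exact hnot 0 hu.2.2.1
      · exact hnot 1 hu.2.2.1
    have h1 := Set.ncard_le_ncard hsub hfin.sdiff
    rw [Set.ncard_sdiff hpair, Set.ncard_pair (mt factorAt_eq_iff.1 hqne)] at h1
    have := ncard_palindromicFactors_le n
    omega
  · refine (Set.ncard_pair (mt factorAt_eq_iff.1 hpne)).ge.trans
      (Set.ncard_le_ncard ?_ (privilegedPalindromes_finite n))
    rintro _ (rfl | rfl)
    · exact (hp 0).1.mem_privilegedPalindromes (hp 0).2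
    · exact (hp 1).1.mem_privilegedPalindromes (hp 1).2

/-! ### Short words -/

/-- The letter at position `n` of the seventh iterate of the morphism on `0`. It agrees with the
Thue–Morse word for `n < 128`, and it can be evaluated by the kernel. -/
def seventhIterate (n : ℕ) : Fin 2 :=
  (thueMorseMorphism^[7] [0]).getD n 0

theorem thueMorse_eq_seventhIterate {n : ℕ} (hn : n < 128) : thueMorse n = seventhIterate n := by
  have := getElem?_thueMorseMorphism_iterate 7 n hn
  rw [seventhIterate, List.getD_eq_getElem?_getD, this, Option.getD_some]

theorem sameFactor_iff_seventhIterate {i j n : ℕ} (hi : i + n ≤ 128) (hj : j + n ≤ 128) :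
    SameFactor i j n ↔ ∀ k < n, seventhIterate (i + k) = seventhIterate (j + k) := by
  refine forall₂_congr fun k hk => ?_
  rw [thueMorse_eq_seventhIterate (by omega), thueMorse_eq_seventhIterate (by omega)]

theorem palindrome_of_seventhIterate {i n : ℕ} (hi : i + n ≤ 128)
    (h : ∀ k < n, seventhIterate (i + k) = seventhIterate (i + (n - 1 - k))) :
    (factorAt i n).Palindrome := by
  rw [palindrome_factorAt_iff]
  intro k hk
  rw [thueMorse_eq_seventhIterate (by omega), thueMorse_eq_seventhIterate (by omega), h k hk]

theorem HasReturnChain.firstReturn_of_seventhIterate {i m n : ℕ} (h : HasReturnChain i m)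
    (hi : i + n ≤ 128) (hmn : m < n)
    (hend : ∀ k < m, seventhIterate (i + k) = seventhIterate (i + (n - m) + k))
    (hno : ∀ p < n - m, 0 < p →
      ¬ ∀ k < m, seventhIterate (i + k) = seventhIterate (i + p + k)) :
    HasReturnChain i n := by
  refine .firstReturn m n h hmn ((sameFactor_iff_seventhIterate (by omega) (by omega)).2 hend)
    fun p hp hp' => ?_
  rw [sameFactor_iff_seventhIterate (by omega) (by omega)]
  exact hno p hp' hp

theorem hasReturnChain_two_of_seventhIterate {i : ℕ} (hi : i + 1 < 128)
    (h : seventhIterate i = seventhIterate (i + 1)) : HasReturnChain i 2 :=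
  .square (by rw [thueMorse_eq_seventhIterate (by omega), thueMorse_eq_seventhIterate hi, h])

theorem hasReturnChain_three_of_seventhIterate {i : ℕ} (hi : i + 2 < 128)
    (h : seventhIterate (i + 1) = seventhIterate i + 1)
    (h' : seventhIterate (i + 2) = seventhIterate i) : HasReturnChain i 3 :=
  .alternating
    (by rw [thueMorse_eq_seventhIterate (by omega), thueMorse_eq_seventhIterate (by omega), h])
    (by rw [thueMorse_eq_seventhIterate (by omega), thueMorse_eq_seventhIterate (by omega), h'])

/-- The palindromic factors of length `6` are `001100`, `110011`, `101101` and `010010`. -/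
theorem fourChainedPalindromes_six : FourChainedPalindromes 6 := by
  refine ⟨![5, 21, 11, 15], fun a => ⟨?_, ?_⟩, fun a b hab => ?_⟩
  · fin_cases a
    · exact (hasReturnChain_two_of_seventhIterate (i := 5) (by decide) (by decide)
        ).firstReturn_of_seventhIterate (by decide) (by decide) (by decide) (by decide)
    · exact (hasReturnChain_two_of_seventhIterate (i := 21) (by decide) (by decide)
        ).firstReturn_of_seventhIterate (by decide) (by decide) (by decide) (by decide)
    · exact (hasReturnChain_three_of_seventhIterate (i := 11) (by decide) (by decide) (by decide)
        ).firstReturn_of_seventhIterate (by decide) (by decide) (by decide) (by decide)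
    · exact (hasReturnChain_three_of_seventhIterate (i := 15) (by decide) (by decide) (by decide)
        ).firstReturn_of_seventhIterate (by decide) (by decide) (by decide) (by decide)
  · exact palindrome_of_seventhIterate (by revert a; decide) (by revert a; decide)
  · rw [sameFactor_iff_seventhIterate (by revert a b; decide) (by revert a b; decide)]
    revert a b
    decide

/-- Of the palindromic factors of length `18`, those at the positions `63` and `47` arise from `010`
and `101` through complete first returns of length `6`; those at the positions `23` and `87` have
`00110100` and `11001011` as prefixes, which are complete first returns to `00` and `11`. -/
theorem twoChainedPalindromes_eighteen : TwoChainedPalindromes 18 := by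
  refine ⟨![63, 47], ![23, 87], fun a => ⟨?_, ?_⟩, fun a => ⟨?_, 8, by decide, ?_, ?_⟩, ?_, ?_⟩
  · have h3 (a : Fin 2) : HasReturnChain (![63, 47] a) 3 :=
      hasReturnChain_three_of_seventhIterate (by revert a; decide) (by revert a; decide)
        (by revert a; decide)
    have h6 (a : Fin 2) : HasReturnChain (![63, 47] a) 6 :=
      (h3 a).firstReturn_of_seventhIterate (by revert a; decide) (by decide) (by revert a; decide)
        (by revert a; decide)
    exact (h6 a).firstReturn_of_seventhIterate (by revert a; decide) (by decide)
      (by revert a; decide) (by revert a; decide)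
  · exact palindrome_of_seventhIterate (by revert a; decide) (by revert a; decide)
  · exact palindrome_of_seventhIterate (by revert a; decide) (by revert a; decide)
  · have h2 (a : Fin 2) : HasReturnChain (![23, 87] a) 2 :=
      hasReturnChain_two_of_seventhIterate (by revert a; decide) (by revert a; decide)
    exact (h2 a).firstReturn_of_seventhIterate (by revert a; decide) (by decide)
      (by revert a; decide) (by revert a; decide)
  · rw [sameFactor_iff_seventhIterate (by revert a; decide) (by revert a; decide)]
    revert a
    decide
  · rw [sameFactor_iff_seventhIterate (by decide) (by decide)]
    decide
  · rw [sameFactor_iff_seventhIterate (by decide) (by decide)]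
    decide

/-! ### The complexity function -/

theorem infinite_of_trimmed_square {Q : ℕ → Prop} {n₀ : ℕ} (hn₀ : 2 ≤ n₀) (h₀ : Q n₀)
    (hQ : ∀ n, Q n → Q (4 * n - 2)) : {n | Q n}.Infinite := by
  have key (a : ℕ) : ∃ n, Q n ∧ 2 ≤ n ∧ a < n := by
    induction a with
    | zero => exact ⟨n₀, h₀, hn₀, by omega⟩
    | succ a ih =>
      obtain ⟨n, hn, h2, ha⟩ := ih
      exact ⟨4 * n - 2, hQ n hn, by omega, by omega⟩
  refine Set.infinite_of_forall_exists_gt fun a => ?_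
  obtain ⟨n, hn, -, ha⟩ := key a
  exact ⟨n, hn, ha⟩

theorem mainTheorem5 :
    (∀ n : ℕ, privilegedPalindromeComplexity thueMorse n ∈ ({0, 1, 2, 4} : Set ℕ)) ∧
    {n : ℕ | privilegedPalindromeComplexity thueMorse n = 0}.Infinite ∧
    {n : ℕ | privilegedPalindromeComplexity thueMorse n = 2}.Infinite ∧
    {n : ℕ | privilegedPalindromeComplexity thueMorse n = 4}.Infinite ∧
    (∀ b : ℕ → ℕ, b 1 = 6 → (∀ n : ℕ, 1 < n → b n = 4 * b (n - 1) - 2) →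
      ∀ n : ℕ, 1 ≤ n → privilegedPalindromeComplexity thueMorse (b n) = 4) := by
  refine ⟨ncard_privilegedPalindromes_mem, ?_, ?_, ?_, fun b hb1 hb n hn => ?_⟩
  · refine Set.infinite_of_forall_exists_gt fun a => ⟨2 * (a + 2) + 1, ?_, by omega⟩
    change (privilegedPalindromes (2 * (a + 2) + 1)).ncard = 0
    rw [Set.subset_empty_iff.1 ((privilegedPalindromes_subset _).trans_eq
      (palindromicFactors_eq_empty_of_odd (by omega))), Set.ncard_empty]
  · exact (infinite_of_trimmed_square (by norm_num) twoChainedPalindromes_eighteen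
      fun _ h => h.trimmed_square).mono fun _ h => h.ncard_eq
  · exact (infinite_of_trimmed_square (by norm_num) fourChainedPalindromes_six
      fun _ h => h.trimmed_square).mono fun _ h => h.ncard_eq
  · suffices h : FourChainedPalindromes (b n) from h.ncard_eq
    induction n, hn using Nat.le_induction with
    | base => exact hb1 ▸ fourChainedPalindromes_six
    | succ n hn ih =>
      rw [hb (n + 1) (by omega), Nat.add_sub_cancel]
      exact ih.trimmed_square
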